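/- **Setting.** A uniform random interval voter (RIV) model is given by an integer $\sigma\ge 1$ and probabilities $p_1,\dots,p_\sigma\in[0,1]$ with $\sum_t p_t=1$; its segments are $I_t=[t,t+1]$, $t=1,\dots,\sigma$. A voter $v$ is sampled by choosing a segment $I_t$ with probability $p_t$, drawing two points independently and uniformly from $I_t$, and letting $a_v\le b_v$ be these points in increasing order; her approval interval is $A^*(v)=[a_v,b_v]$. Let $C\subset\bigcup_t I_t$ be a finite set of $m$ candidates (identified with their positions), let $n\ge 1$ voters be sampled independently, and let $0\le k\le m$ be the committee size. Voter $v$ approves the candidates in $A(v)=A^*(v)\cap C$. A committee $W\subseteq C$ is *core stable* if $|W|=k$ and for every $\ell\in\{1,\dots,k\}$, every $T\subseteq C$ with $|T|\le\ell$, and every group $G$ of at least $n\ell/k$ voters, there is a voter $v\in G$ with $|W\cap A(v)|\ge|T\cap A(v)|$. An algorithm that knows the model, $C$, $n$ and $k$ learns about the voters only through adaptive yes/no queries, each put to one voter $v$: a point query "is $c\in A(v)$?" for a candidate $c\in C$, or an interval query "is $A^*(v)\subseteq[x,y]$?", where each of $x,y$ is a candidate or a segment endpoint in $\{1,\dots,\sigma+1\}$.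 It may stop after any number of queries and output a committee. **Corollary 1.** There is an absolute constant $K>0$ such that for every uniform RIV model, every such $C$ with $|C|=m$, every $n\ge 1$ and every $0\le k\le m$ there is an adaptive query algorithm that 1. outputs a core-stable committee whenever each voter's approval interval lies in a single segment (in particular, with probability $1$), and 2. for each voter $v$, puts at most $K\log m$ queries to $v$ in expectation over the sampled voters (for $m\in\{0,1\}$ it puts no query, almost surely). -/

import Mathlib

open MeasureTheory
open scoped ENNReal

noncomputable section

/-- A multiwinner voting election `E = (V, C, k, A)` with approval ballots: `V` is the set of
voters, `C` the finite set of candidates, `k` the number of candidates to elect, and `A v ⊆ C` the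
set of candidates approved by the voter `v`. -/
structure Election (V X : Type*) where
  C : Finset X
  k : ℕ
  A : V → Finset X
  A_subset : ∀ v, A v ⊆ C

/-- The committee `W` is core stable: it is a set of `k` candidates, and for every `ℓ ∈ {1, …, k}`,
every `T ⊆ C` with `|T| ≤ ℓ` and every group `G` of at least `n ℓ / k` voters (`n = |V|`), some
voter `v ∈ G` has `|W ∩ A(v)| ≥ |T ∩ A(v)|`. -/
def Election.InCore {V X : Type*} [Fintype V] [DecidableEq X] (E : Election V X)
    (W : Finset X) : Prop :=
  W ⊆ E.C ∧ W.card = E.k ∧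
    ∀ ℓ : ℕ, 1 ≤ ℓ → ℓ ≤ E.k → ∀ T : Finset X, T ⊆ E.C → T.card ≤ ℓ →
      ∀ G : Finset V, (Fintype.card V : ℝ) * (ℓ : ℝ) / (E.k : ℝ) ≤ (G.card : ℝ) →
        ∃ v ∈ G, (T ∩ E.A v).card ≤ (W ∩ E.A v).card

/-- A uniform random interval voter model with `σ` segments, given by the probabilities `p` of the
segments. The segments are numbered from `0`, so `t : Fin σ` stands for the segment
`[t + 1, t + 2]`. -/
structure UniformRIV where
  σ : ℕ
  p : Fin σ → ℝ
  p_mem : ∀ t, p t ∈ Set.Icc (0 : ℝ) 1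
  p_sum : ∑ t, p t = 1

namespace UniformRIV

/-- The segments `[1, 2], [2, 3], …, [σ, σ + 1]` of the model. -/
def segment (M : UniformRIV) (t : Fin M.σ) : Set ℝ :=
  Set.Icc ((t : ℝ) + 1) ((t : ℝ) + 2)

/-- The law of the endpoints `(a, b)` of the approval interval of a sampled voter: a segment `t` is
chosen with probability `p t`, two points `x, y` are drawn independently and uniformly from the
segment (which has length one, so that the restriction of Lebesgue measure to it is the uniform
distribution), and `a = min x y`, `b = max x y`. -/
def voterLaw (M : UniformRIV) : Measure (ℝ × ℝ) :=
  ∑ t : Fin M.σ, ENNReal.ofReal (M.p t) •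
    Measure.map (fun z : ℝ × ℝ => (min z.1 z.2, max z.1 z.2))
      ((volume.restrict (M.segment t)).prod (volume.restrict (M.segment t)))

instance isProbabilityMeasure_voterLaw (M : UniformRIV) : IsProbabilityMeasure M.voterLaw := by
  have hseg : ∀ t, IsProbabilityMeasure (volume.restrict (M.segment t)) := fun t => ⟨by
    rw [Measure.restrict_apply_univ, segment, Real.volume_Icc]
    norm_num⟩
  have hmeas : Measurable (fun z : ℝ × ℝ => (min z.1 z.2, max z.1 z.2)) := by fun_prop
  refine ⟨?_⟩
  have h1 : ∀ t, (Measure.map (fun z : ℝ × ℝ => (min z.1 z.2, max z.1 z.2))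
      ((volume.restrict (M.segment t)).prod (volume.restrict (M.segment t)))) Set.univ = 1 := by
    intro t
    rw [Measure.map_apply hmeas MeasurableSet.univ, Set.preimage_univ, measure_univ]
  simp only [voterLaw, Measure.coe_finsetSum, Finset.sum_apply, Measure.smul_apply, h1,
    smul_eq_mul, mul_one]
  rw [← ENNReal.ofReal_sum_of_nonneg (fun t _ => (M.p_mem t).1), M.p_sum, ENNReal.ofReal_one]

/-- The law of the approval intervals of `n` voters that are sampled independently. -/
def profileLaw (M : UniformRIV) (n : ℕ) : Measure (Fin n → ℝ × ℝ) :=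
  Measure.pi fun _ => M.voterLaw

/-- `(a, b)` are the endpoints of an interval that a voter of the model can hold: `a ≤ b`, and both
endpoints lie in the same segment. -/
def IsVoter (M : UniformRIV) (z : ℝ × ℝ) : Prop :=
  z.1 ≤ z.2 ∧ ∃ t, z.1 ∈ M.segment t ∧ z.2 ∈ M.segment t

end UniformRIV

/-- The election with candidates `C` (identified with their positions on the line) and committee
size `k` in which voter `v` approves the candidates in the interval with endpoints `z v`. -/
def intervalElection {n : ℕ} (C : Finset ℝ) (k : ℕ) (z : Fin n → ℝ × ℝ) :
    Election (Fin n) ℝ where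
  C := C
  k := k
  A v := {c ∈ C | c ∈ Set.Icc (z v).1 (z v).2}
  A_subset _ := Finset.filter_subset _ _

/-- The endpoints `1, 2, …, σ + 1` of the segments. -/
def segmentEndpoints (σ : ℕ) : Finset ℝ :=
  (Finset.Icc 1 (σ + 1)).image (fun i : ℕ => (i : ℝ))

/-- A query to a voter. A point query names a candidate; an interval query names two positions, each
of which is a candidate or an endpoint of a segment. -/
inductive Query (σ : ℕ) (C : Finset ℝ) : Type
  | point (c : ℝ) (hc : c ∈ C) : Query σ C
  | interval (x y : ℝ) (hx : x ∈ C ∪ segmentEndpoints σ) (hy : y ∈ C ∪ segmentEndpoints σ) :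
      Query σ C

open Classical in
/-- The answer of a voter whose approval interval is `[z.1, z.2]`: for a point query, whether the
candidate is approved; for an interval query, whether the whole approval interval is contained in
`[x, y]`. -/
def Query.answer {σ : ℕ} {C : Finset ℝ} (z : ℝ × ℝ) : Query σ C → Bool
  | .point c _ => decide (c ∈ Set.Icc z.1 z.2)
  | .interval x y _ _ => decide (Set.Icc z.1 z.2 ⊆ Set.Icc x y)

/-- An adaptive query algorithm for `n` voters, as a decision tree: it either stops and outputs a
set of candidates, or puts a query to one of the voters and continues depending on the answer. The
tree is well-founded, so that every execution ends after finitely many queries. -/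
inductive QueryAlgorithm (σ : ℕ) (C : Finset ℝ) (n : ℕ) : Type
  | output (W : Finset ℝ) : QueryAlgorithm σ C n
  | ask (v : Fin n) (q : Query σ C) (next : Bool → QueryAlgorithm σ C n) : QueryAlgorithm σ C n

namespace QueryAlgorithm

/-- The output of the algorithm on voters with approval intervals `z`. -/
def run {σ n : ℕ} {C : Finset ℝ} (z : Fin n → ℝ × ℝ) : QueryAlgorithm σ C n → Finset ℝ
  | .output W => W
  | .ask v q next => (next (q.answer (z v))).run z

/-- The number of queries that the algorithm puts to voter `w` when the voters have approval
intervals `z`. -/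
def queries {σ n : ℕ} {C : Finset ℝ} (z : Fin n → ℝ × ℝ) (w : Fin n) :
    QueryAlgorithm σ C n → ℕ
  | .output _ => 0
  | .ask v q next => (if v = w then 1 else 0) + (next (q.answer (z v))).queries z w

end QueryAlgorithm

end

/-! Core stability depends only on the approval sets, so it suffices to learn every `A v` with O(log
m) queries and to know that interval elections have core stable committees.

Existence (`exists_unblocked`): scan the candidates from left to right, keeping a committee that no
coalition of voters confined to the scanned candidates blocks, and that spends at most one seat per
`n / k` such voters. While a new coalition blocks, elect the rightmost unelected candidate.
`card_succ_le_of_blocked` shows that a block always leaves enough voters to pay for this seat; its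
induction needs the budget to hold also to the left of every unelected candidate.

Learning (`UniformRIV.Learns.approved`): an interval query with one end at `1` or `σ + 1` compares a
single endpoint of the approval interval with a candidate. Binary search locates both endpoints up
to equality with a candidate, and two point queries settle the ties. The bound holds for every
profile, hence in expectation. -/

/-- The coalition that prefers `T` to `W`, among the voters that approve only candidates of `D`. -/
def coalition {V X : Type*} [Fintype V] [DecidableEq X] (A : V → Finset X) (D W T : Finset X) :
    Finset V :=
  {v | A v ⊆ D ∧ (W ∩ A v).card < (T ∩ A v).card}

/-- Voters that approve only candidates of `D`. -/
def votersWithin {V X : Type*} [Fintype V] [DecidableEq X] (A : V → Finset X) (D : Finset X) :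
    Finset V :=
  {v | A v ⊆ D}

/-! ### Core stable committees for interval approvals -/

section Greedy

variable {V X : Type*} [Fintype V] [LinearOrder X] {n k : ℕ} {A : V → Finset X} {r : X}
  {D W T : Finset X}

@[simp] theorem mem_coalition {v : V} :
    v ∈ coalition A D W T ↔ A v ⊆ D ∧ (W ∩ A v).card < (T ∩ A v).card := by
  simp [coalition]

@[simp] theorem mem_votersWithin {v : V} : v ∈ votersWithin A D ↔ A v ⊆ D := by
  simp [votersWithin]

/-- Voters confined to `E` do not see the candidates of `T` outside `E`. -/
theorem coalition_subset_filter {E : Finset X} (hE : E ⊆ D) :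
    coalition A E W T ⊆ coalition A D W {c ∈ T | c ∈ E} := by
  intro v hv
  rw [mem_coalition] at hv ⊢
  refine ⟨hv.1.trans hE, hv.2.trans_le (Finset.card_le_card fun c hc => ?_)⟩
  rw [Finset.mem_inter] at hc
  simp [hc.1, hc.2, hv.1 hc.2]

theorem coalition_empty_right : coalition A D W ∅ = ∅ := by
  ext v
  simp

theorem mul_card_coalition_le
    (hD : ∀ T ⊆ D, T.Nonempty → k * (coalition A D W T).card < n * T.card)
    {E : Finset X} (hE : E ⊆ D) :
    k * (coalition A E W T).card ≤ n * {c ∈ T | c ∈ E}.card := by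
  have h := Nat.mul_le_mul_left k
    (Finset.card_le_card (coalition_subset_filter (A := A) (W := W) (T := T) hE))
  rcases Finset.eq_empty_or_nonempty {c ∈ T | c ∈ E} with h0 | h0
  · rw [h0, coalition_empty_right] at h
    simpa [h0] using h
  · exact h.trans (hD _ (fun c hc => hE (Finset.mem_filter.1 hc).2) h0).le

/-- The key step of the greedy construction: if some coalition of voters that approve only
candidates of `insert r D` blocks `W`, although none of the voters that approve only candidates
of `D` does, then there is room for one more candidate. -/
theorem card_succ_le_of_blocked (hn : 0 < n) (hr : ∀ x ∈ D, x < r)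
    (hA : ∀ v, ∀ x ∈ A v, ∀ y ∈ A v, ∀ c ∈ insert r D, x ≤ c → c ≤ y → c ∈ A v)
    (hD : ∀ T ⊆ D, T.Nonempty → k * (coalition A D W T).card < n * T.card)
    (hW : W ⊆ insert r D)
    (hz : ∀ z ∈ insert r D, z ∉ W → n * {c ∈ W | c < z}.card ≤
      k * (votersWithin A {c ∈ insert r D | c < z}).card)
    (hT : T ⊆ insert r D) (hT0 : T.Nonempty)
    (hblock : n * T.card ≤ k * (coalition A (insert r D) W T).card) :
    (∃ y ∈ insert r D, y ∉ W) ∧ n * (W.card + 1) ≤ k * (votersWithin A (insert r D)).card := by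
  -- Otherwise the coalition is confined to `D`, where `T ∩ D`, which is no larger than `T`, already
  -- fails to block.
  obtain ⟨v, hv, hvr⟩ : ∃ v ∈ coalition A (insert r D) W T, r ∈ A v := by
    by_contra! hcon
    have hsub : coalition A (insert r D) W T ⊆ coalition A D W T := by
      intro v hv
      have hr := hcon v hv
      rw [mem_coalition] at hv ⊢
      exact ⟨(Finset.subset_insert_iff_of_notMem hr).1 hv.1, hv.2⟩
    have h1 := Nat.mul_le_mul_left k (Finset.card_le_card hsub)
    by_cases hTD : T ⊆ D
    · have := hD T hTD hT0
      omega
    · have h2 := mul_card_coalition_le (T := T) hD subset_rfl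
      have h3 : {c ∈ T | c ∈ D}.card < T.card :=
        Finset.card_lt_card (Finset.filter_ssubset.2 (Finset.not_subset.1 hTD))
      have := Nat.mul_lt_mul_of_pos_left h3 hn
      omega
  rw [mem_coalition] at hv
  have hne : (A v \ W).Nonempty := by
    rw [Finset.sdiff_nonempty]
    intro h
    rw [Finset.inter_eq_right.2 h] at hv
    exact absurd (Finset.card_le_card Finset.inter_subset_right) (not_le.2 hv.2)
  -- To the left of `z`, `v` approves only elected candidates; from `z` to `r` she approves
  -- everything. So `T` beats `W` strictly among the candidates from `z` on.
  set z := (A v \ W).min' hne with hzdef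
  obtain ⟨hzA, hzW⟩ := Finset.mem_sdiff.1 (Finset.min'_mem _ hne)
  rw [← hzdef] at hzA hzW
  have hzD := hv.1 hzA
  refine ⟨⟨z, hzD, hzW⟩, ?_⟩
  have hmin : ∀ c ∈ A v, c < z → c ∈ W := by
    intro c hc hcz
    by_contra hcW
    exact absurd (Finset.min'_le _ c (Finset.mem_sdiff.2 ⟨hc, hcW⟩)) (not_le.2 hcz)
  have hle : ∀ x ∈ insert r D, x ≤ r := by
    intro x hx
    rcases Finset.mem_insert.1 hx with rfl | h
    exacts [le_rfl, (hr x h).le]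
  have hE : {c ∈ insert r D | c < z} ⊆ D := by
    intro c hc
    rw [Finset.mem_filter, Finset.mem_insert] at hc
    rcases hc.1 with rfl | h
    · exact absurd (hle z hzD) (not_le.2 hc.2)
    · exact h
  have hcount : W.card + 1 ≤ {c ∈ W | c < z}.card + {c ∈ T | ¬ c < z}.card := by
    have h1 := Finset.card_filter_add_card_filter_not (s := W) (fun c => c < z)
    have h2 := Finset.card_filter_add_card_filter_not (s := W ∩ A v) (fun c => c < z)
    have h3 := Finset.card_filter_add_card_filter_not (s := T ∩ A v) (fun c => c < z)
    have h4 : {c ∈ W | ¬ c < z}.card ≤ {c ∈ W ∩ A v | ¬ c < z}.card := by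
      refine Finset.card_le_card fun c hc => ?_
      rw [Finset.mem_filter] at hc
      have hcD := hW hc.1
      simp only [Finset.mem_filter, Finset.mem_inter]
      exact ⟨⟨hc.1, hA v z hzA r hvr c hcD (not_lt.1 hc.2) (hle c hcD)⟩, hc.2⟩
    have h5 : {c ∈ T ∩ A v | c < z}.card ≤ {c ∈ W ∩ A v | c < z}.card := by
      refine Finset.card_le_card fun c hc => ?_
      simp only [Finset.mem_filter, Finset.mem_inter] at hc ⊢
      exact ⟨⟨hmin c hc.1.2 hc.2, hc.1.2⟩, hc.2⟩
    have h6 : {c ∈ T ∩ A v | ¬ c < z}.card ≤ {c ∈ T | ¬ c < z}.card :=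
      Finset.card_le_card (Finset.filter_subset_filter _ Finset.inter_subset_left)
    omega
  have h1 := hz z hzD hzW
  have h2 : k * (coalition A {c ∈ insert r D | c < z} W T).card ≤ n * {c ∈ T | c < z}.card := by
    refine (mul_card_coalition_le hD hE).trans (Nat.mul_le_mul_left n (Finset.card_le_card ?_))
    intro c hc
    simp only [Finset.mem_filter] at hc ⊢
    exact ⟨hc.1, hc.2.2⟩
  -- Inclusion-exclusion: members of the coalition confined to the left of `z` form the smaller
  -- coalition. Hence the seats of `T` from `z` on are paid for by voters not confined to the left
  -- of `z`, and `h1` pays for the seats of `W` to the left of `z`.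
  have h3 : (coalition A (insert r D) W T).card +
      (votersWithin A {c ∈ insert r D | c < z}).card ≤
      (coalition A {c ∈ insert r D | c < z} W T).card + (votersWithin A (insert r D)).card := by
    classical
    rw [← Finset.card_union_add_card_inter, add_comm]
    refine Nat.add_le_add (Finset.card_le_card fun w hw => ?_)
      (Finset.card_le_card fun w hw => ?_)
    · simp only [Finset.mem_inter, mem_coalition, mem_votersWithin] at hw ⊢
      exact ⟨hw.2, hw.1.2⟩
    · simp only [Finset.mem_union, mem_coalition, mem_votersWithin] at hw ⊢
      rcases hw with hw | hw
      exacts [hw.1, hw.trans (Finset.filter_subset _ _)]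
  have h4 := Finset.card_filter_add_card_filter_not (s := T) (fun c => c < z)
  have h5 := Nat.mul_le_mul_left k h3
  have h6 := Nat.mul_le_mul_left n hcount
  have h7 := congrArg (n * ·) h4
  simp only [mul_add] at h5 h6 h7 ⊢
  omega

/-- If the approval sets are intervals of the linearly ordered set of candidates, a committee that
no coalition blocks exists, with at most one seat for every `n / k` voters. -/
theorem exists_unblocked (hn : 0 < n) (A : V → Finset X) (D : Finset X)
    (hA : ∀ v, ∀ x ∈ A v, ∀ y ∈ A v, ∀ c ∈ D, x ≤ c → c ≤ y → c ∈ A v) :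
    ∃ W ⊆ D, (∀ T ⊆ D, T.Nonempty → k * (coalition A D W T).card < n * T.card) ∧
      n * W.card ≤ k * (votersWithin A D).card ∧
      ∀ z ∈ D, z ∉ W → n * {c ∈ W | c < z}.card ≤
        k * (votersWithin A {c ∈ D | c < z}).card := by
  induction D using Finset.induction_on_max with
  | empty =>
    refine ⟨∅, subset_rfl, fun T hT hT0 => ?_, by simp, by simp⟩
    exact absurd (Finset.subset_empty.1 hT) hT0.ne_empty
  | insert r D hr ih =>
    obtain ⟨W₀, hW₀, hD₀, hcard₀, hz₀⟩ := ih fun v x hx y hy c hc =>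
      hA v x hx y hy c (Finset.mem_insert_of_mem hc)
    have hfilter : ∀ z ∈ D, {c ∈ insert r D | c < z} = {c ∈ D | c < z} := by
      intro z hz
      rw [Finset.filter_insert, if_neg (hr z hz).not_gt]
    have hfilter_top : {c ∈ insert r D | c < r} = D := by
      rw [Finset.filter_insert, if_neg (lt_irrefl r), Finset.filter_true_of_mem hr]
    have hmono : (votersWithin A D).card ≤ (votersWithin A (insert r D)).card := by
      refine Finset.card_le_card fun v hv => ?_
      rw [mem_votersWithin] at hv ⊢
      exact hv.trans (Finset.subset_insert r D)
    -- The desired invariants, with blocking still tested only on `D`. A `good` committee of maximal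
    -- size cannot be blocked on `insert r D` either.
    let good : Finset X → Prop := fun W => W ⊆ insert r D ∧
      (∀ T ⊆ D, T.Nonempty → k * (coalition A D W T).card < n * T.card) ∧
      n * W.card ≤ k * (votersWithin A (insert r D)).card ∧
      ∀ z ∈ insert r D, z ∉ W → n * {c ∈ W | c < z}.card ≤
        k * (votersWithin A {c ∈ insert r D | c < z}).card
    have hgood₀ : good W₀ := by
      refine ⟨hW₀.trans (Finset.subset_insert r D), hD₀,
        hcard₀.trans (Nat.mul_le_mul_left k hmono), fun z hz hzW => ?_⟩
      rcases Finset.mem_insert.1 hz with rfl | hz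
      · rw [hfilter_top]
        exact (Nat.mul_le_mul_left n (Finset.card_filter_le _ _)).trans hcard₀
      · rw [hfilter z hz]
        exact hz₀ z hz hzW
    classical
    obtain ⟨W, hW, hmax⟩ := Finset.exists_max_image
      ((insert r D).powerset.filter good) Finset.card
      ⟨W₀, Finset.mem_filter.2 ⟨Finset.mem_powerset.2 hgood₀.1, hgood₀⟩⟩
    obtain ⟨hWD, hD, hcard, hz⟩ := (Finset.mem_filter.1 hW).2
    refine ⟨W, hWD, ?_, hcard, hz⟩
    by_contra! hcon
    obtain ⟨T, hT, hT0, hblock⟩ := hcon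
    obtain ⟨⟨y₀, hy₀, hy₀W⟩, hroom⟩ :=
      card_succ_le_of_blocked hn hr hA hD hWD hz hT hT0 hblock
    have hne : (insert r D \ W).Nonempty := ⟨y₀, Finset.mem_sdiff.2 ⟨hy₀, hy₀W⟩⟩
    -- With the rightmost unelected candidate added, the seats to the left of any other unelected
    -- candidate are unchanged, so the last invariant survives.
    set y := (insert r D \ W).max' hne with hydef
    obtain ⟨hyD, hyW⟩ := Finset.mem_sdiff.1 (Finset.max'_mem _ hne)
    rw [← hydef] at hyD hyW
    have hgood : good (insert y W) := by
      refine ⟨Finset.insert_subset hyD hWD, fun T' hT' hT0' => ?_, ?_, fun z hzD hzW => ?_⟩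
      · refine (Nat.mul_le_mul_left k (Finset.card_le_card fun v hv => ?_)).trans_lt
          (hD T' hT' hT0')
        rw [mem_coalition] at hv ⊢
        exact ⟨hv.1, (Finset.card_le_card (Finset.inter_subset_inter_right
          (Finset.subset_insert y W))).trans_lt hv.2⟩
      · rwa [Finset.card_insert_of_notMem hyW]
      · rw [Finset.mem_insert, not_or] at hzW
        have hzy : z ≤ y := Finset.le_max' _ z (Finset.mem_sdiff.2 ⟨hzD, hzW.2⟩)
        rw [Finset.filter_insert, if_neg hzy.not_gt]
        exact hz z hzD hzW.2
    have := hmax _ (Finset.mem_filter.2 ⟨Finset.mem_powerset.2 hgood.1, hgood⟩)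
    rw [Finset.card_insert_of_notMem hyW] at this
    omega

end Greedy

/-- An approval election whose approval sets are intervals of the linearly ordered set of
candidates has a core stable committee. -/
theorem Election.exists_inCore {V X : Type*} [Fintype V] [Nonempty V] [LinearOrder X]
    (E : Election V X) (hk : E.k ≤ E.C.card)
    (hA : ∀ v, ∀ x ∈ E.A v, ∀ y ∈ E.A v, ∀ c ∈ E.C, x ≤ c → c ≤ y → c ∈ E.A v) :
    ∃ W, E.InCore W := by
  obtain ⟨W₀, hW₀, hblock, hcard, -⟩ :=
    exists_unblocked (k := E.k) (Fintype.card_pos (α := V)) E.A E.C hA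
  have hcard' : W₀.card ≤ E.k := by
    have h : (votersWithin E.A E.C).card ≤ Fintype.card V := Finset.card_le_univ _
    have h' := hcard.trans (Nat.mul_le_mul_left E.k h)
    rw [mul_comm E.k] at h'
    exact Nat.le_of_mul_le_mul_left h' Fintype.card_pos
  -- Filling up the remaining seats only shrinks coalitions.
  obtain ⟨W, hsub, hWC, hWk⟩ := Finset.exists_subsuperset_card_eq hW₀ hcard' hk
  refine ⟨W, hWC, hWk, fun ℓ hℓ hℓk T hT hTℓ G hG => ?_⟩
  have hk0 : (0 : ℝ) < E.k := by exact_mod_cast hℓ.trans hℓk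
  rw [div_le_iff₀ hk0] at hG
  have hG' : Fintype.card V * ℓ ≤ G.card * E.k := by exact_mod_cast hG
  by_contra! hcon
  have hGsub : G ⊆ coalition E.A E.C W₀ T := by
    intro v hv
    rw [mem_coalition]
    exact ⟨E.A_subset v, (Finset.card_le_card (Finset.inter_subset_inter_right hsub)).trans_lt
      (hcon v hv)⟩
  have h1 := Nat.mul_le_mul_left E.k (Finset.card_le_card hGsub)
  have h2 : 0 < Fintype.card V * ℓ := Nat.mul_pos Fintype.card_pos hℓ
  have h3 := Nat.mul_le_mul_left (Fintype.card V) hTℓ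
  rcases T.eq_empty_or_nonempty with rfl | hT0
  · rw [coalition_empty_right, Finset.card_empty, mul_zero, mul_comm] at h1
    omega
  · have := hblock T hT hT0
    rw [mul_comm E.k G.card] at h1
    omega

/-! ### Learning from a single voter -/

namespace UniformRIV

/-- With at most `d` queries to the voter `v` an algorithm can find out the value of `g` at her
approval interval, provided that this interval lies in a segment of the model. -/
def Learns (M : UniformRIV) (C : Finset ℝ) {n : ℕ} (v : Fin n) {β : Type} (d : ℕ)
    (g : ℝ × ℝ → β) : Prop :=
  -- The continuation `next` receives the learned value. For an interval outside the model `u` may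
  -- be wrong, but the query bound still holds.
  ∀ next : β → QueryAlgorithm M.σ C n, ∃ P : QueryAlgorithm M.σ C n,
    ∀ z : Fin n → ℝ × ℝ, ∃ u : β, (M.IsVoter (z v) → u = g (z v)) ∧
      P.run z = (next u).run z ∧
      ∀ w, P.queries z w ≤ (if v = w then d else 0) + (next u).queries z w

variable {M : UniformRIV} {C : Finset ℝ} {n : ℕ} {v : Fin n} {β γ : Type}

theorem Learns.of_forall_eq {g : ℝ × ℝ → β} (d : ℕ) (b : β) (h : ∀ x, M.IsVoter x → g x = b) :
    M.Learns C v d g :=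
  fun next => ⟨next b, fun _ => ⟨b, fun hz => (h _ hz).symm, rfl, fun _ => Nat.le_add_left _ _⟩⟩

theorem Learns.answer (q : Query M.σ C) : M.Learns C v 1 (fun x => q.answer x) :=
  fun next => ⟨.ask v q next, fun z => ⟨q.answer (z v), fun _ => rfl, rfl, fun _ => le_rfl⟩⟩

theorem Learns.congr {d : ℕ} {g g' : ℝ × ℝ → β} (h : M.Learns C v d g)
    (hg : ∀ x, M.IsVoter x → g x = g' x) : M.Learns C v d g' := by
  intro next
  obtain ⟨P, hP⟩ := h next
  refine ⟨P, fun z => ?_⟩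
  obtain ⟨u, hu, h⟩ := hP z
  exact ⟨u, fun hz => (hu hz).trans (hg _ hz), h⟩

theorem Learns.bind {d₁ d₂ : ℕ} {g₁ : ℝ × ℝ → β} {g₂ : β → ℝ × ℝ → γ}
    (h₁ : M.Learns C v d₁ g₁) (h₂ : ∀ b, M.Learns C v d₂ (g₂ b)) :
    M.Learns C v (d₁ + d₂) (fun x => g₂ (g₁ x) x) := by
  intro next
  choose Q hQ using fun b => h₂ b next
  obtain ⟨P, hP⟩ := h₁ Q
  refine ⟨P, fun z => ?_⟩
  obtain ⟨u₁, hu₁, hrun₁, hq₁⟩ := hP z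
  obtain ⟨u₂, hu₂, hrun₂, hq₂⟩ := hQ u₁ z
  refine ⟨u₂, fun hz => ?_, hrun₁.trans hrun₂, fun w => ?_⟩
  · rw [hu₂ hz, hu₁ hz]
  · have h1 := hq₁ w
    have h2 := hq₂ w
    split_ifs at h1 h2 ⊢ <;> omega

theorem Learns.map {d : ℕ} {g : ℝ × ℝ → β} (h : M.Learns C v d g) (f : β → γ) :
    M.Learns C v d (fun x => f (g x)) :=
  h.bind (d₂ := 0) (g₂ := fun b _ => f b) fun b => .of_forall_eq 0 (f b) fun _ _ => rfl

end UniformRIV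

/-- A nonempty finite set in a linear order with fewer than `2 ^ (d + 1)` elements has an element
with fewer than `2 ^ d` elements on either side. -/
theorem Finset.exists_bisection {α : Type*} [LinearOrder α] {S : Finset α} (hS : S.Nonempty)
    {d : ℕ} (hd : S.card < 2 ^ (d + 1)) :
    ∃ c ∈ S, {x ∈ S | x < c}.card < 2 ^ d ∧ {x ∈ S | c < x}.card < 2 ^ d := by
  have hpos := Finset.card_pos.2 hS
  let e := S.orderEmbOfFin rfl
  let i : Fin S.card := ⟨S.card / 2, by omega⟩
  have hmem : ∀ j, e j ∈ S := S.orderEmbOfFin_mem rfl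
  have hsurj : ∀ x ∈ S, ∃ j, e j = x := by
    intro x hx
    have : x ∈ Set.range e := by
      rw [Finset.range_orderEmbOfFin]
      exact hx
    exact this
  have hlt : {x ∈ S | x < e i} = (Finset.Iio i).map e.toEmbedding := by
    ext x
    simp only [Finset.mem_filter, Finset.mem_map, Finset.mem_Iio]
    constructor
    · rintro ⟨hx, hxi⟩
      obtain ⟨j, rfl⟩ := hsurj x hx
      exact ⟨j, e.lt_iff_lt.1 hxi, rfl⟩
    · rintro ⟨j, hj, rfl⟩
      exact ⟨hmem j, e.lt_iff_lt.2 hj⟩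
  have hgt : {x ∈ S | e i < x} = (Finset.Ioi i).map e.toEmbedding := by
    ext x
    simp only [Finset.mem_filter, Finset.mem_map, Finset.mem_Ioi]
    constructor
    · rintro ⟨hx, hxi⟩
      obtain ⟨j, rfl⟩ := hsurj x hx
      exact ⟨j, e.lt_iff_lt.1 hxi, rfl⟩
    · rintro ⟨j, hj, rfl⟩
      exact ⟨hmem j, e.lt_iff_lt.2 hj⟩
  rw [pow_succ] at hd
  refine ⟨e i, hmem i, ?_, ?_⟩
  · rw [hlt, Finset.card_map, Fin.card_Iio]
    change S.card / 2 < 2 ^ d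
    omega
  · rw [hgt, Finset.card_map, Fin.card_Ioi]
    change S.card - 1 - S.card / 2 < 2 ^ d
    omega

namespace UniformRIV

variable {M : UniformRIV} {C : Finset ℝ} {n : ℕ} {v : Fin n}

open Classical in
/-- Binary search for the cutoff of a predicate that is antitone in the candidate. -/
theorem Learns.binarySearch {p : ℝ × ℝ → ℝ → Prop}
    (hp : ∀ x, ∀ c c', c' ≤ c → p x c → p x c')
    (hC : ∀ c ∈ C, M.Learns C v 1 (fun x => decide (p x c))) (d : ℕ) :
    ∀ S ⊆ C, S.card < 2 ^ d → M.Learns C v d (fun x => {c ∈ S | p x c}) := by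
  induction d with
  | zero =>
    intro S _ hd
    have : S = ∅ := by simpa using hd
    subst this
    exact .of_forall_eq 0 ∅ fun _ _ => by simp
  | succ d ih =>
    intro S hS hd
    rcases S.eq_empty_or_nonempty with rfl | hne
    · exact .of_forall_eq _ ∅ fun _ _ => by simp
    obtain ⟨c, hc, hlt, hgt⟩ := Finset.exists_bisection hne hd
    have hlow := ih _ ((Finset.filter_subset (fun x => x < c) S).trans hS) hlt
    have hhigh := (ih _ ((Finset.filter_subset (fun x => c < x) S).trans hS) hgt).map
      (fun U => {x ∈ S | x ≤ c} ∪ U)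
    -- A yes at `c` settles all candidates up to `c`, a no all from `c` on; fewer than `2 ^ d`
    -- remain.
    have key := (hC c (hS hc)).bind (g₂ := fun (b : Bool) (x : ℝ × ℝ) => if b = true then
      {y ∈ S | y ≤ c} ∪ {y ∈ {y ∈ S | c < y} | p x y} else {y ∈ {y ∈ S | y < c} | p x y})
      (d₂ := d) fun b => by
        cases b
        · simpa using hlow
        · simpa using hhigh
    rw [add_comm]
    refine key.congr fun x _ => ?_
    ext y
    by_cases hx : p x c
    · have := hp x c y
      have := le_or_gt y c
      simp only [hx, decide_true, if_true, Finset.mem_union, Finset.mem_filter]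
      tauto
    · have h1 := hp x y c
      have h2 := le_or_gt c y
      simp only [hx, decide_false, Bool.false_eq_true, if_false, Finset.mem_filter]
      tauto

open Classical in
/-- The candidates approved by a voter with approval interval `[x.1, x.2]`. -/
noncomputable def approved (C : Finset ℝ) (x : ℝ × ℝ) : Finset ℝ :=
  {c ∈ C | c ∈ Set.Icc x.1 x.2}

theorem Learns.approved_filter (D : Finset ℝ) :
    M.Learns C v D.card (fun x => {c ∈ approved C x | c ∈ D}) := by
  induction D using Finset.induction_on with
  | empty => exact .of_forall_eq _ ∅ fun _ _ => by simp
  | insert a D ha ih =>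
    rw [Finset.card_insert_of_notMem ha]
    by_cases haC : a ∈ C
    · refine (ih.bind (g₂ := fun U x => if (Query.point (σ := M.σ) a haC).answer x = true
        then insert a U else U) fun U =>
          (Learns.answer _).map (fun b : Bool => if b = true then insert a U else U)).congr
        fun x _ => ?_
      ext c
      simp only [Query.answer, approved, decide_eq_true_eq]
      split_ifs with h
      · simp only [Finset.mem_insert, Finset.mem_filter]
        constructor
        · rintro (rfl | h')
          · exact ⟨⟨haC, h⟩, Or.inl rfl⟩
          · exact ⟨h'.1, Or.inr h'.2⟩
        · tauto
      · simp only [Finset.mem_insert, Finset.mem_filter]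
        constructor
        · tauto
        · rintro ⟨h', rfl | h''⟩
          · exact absurd h'.2 h
          · exact ⟨h', h''⟩
    · refine (ih.bind (g₂ := fun U _ => U) fun U => .of_forall_eq 1 U fun _ _ => rfl).congr
        fun x _ => ?_
      ext c
      simp only [approved, Finset.mem_insert, Finset.mem_filter]
      constructor
      · tauto
      · rintro ⟨h', rfl | h''⟩
        · exact absurd h'.1 haC
        · exact ⟨h', h''⟩

theorem Learns.mono {β : Type} {d d' : ℕ} {g : ℝ × ℝ → β} (h : M.Learns C v d g) (hd : d ≤ d') :
    M.Learns C v d' g := by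
  obtain ⟨e, rfl⟩ := Nat.exists_eq_add_of_le hd
  exact h.bind (g₂ := fun b _ => b) fun b => .of_forall_eq e b fun _ _ => rfl

theorem IsVoter.one_le {x : ℝ × ℝ} (h : M.IsVoter x) : 1 ≤ x.1 := by
  obtain ⟨-, t, ht, -⟩ := h
  have : (0 : ℝ) ≤ t := Nat.cast_nonneg _
  linarith [ht.1]

theorem IsVoter.le_add_one {x : ℝ × ℝ} (h : M.IsVoter x) : x.2 ≤ M.σ + 1 := by
  obtain ⟨-, t, -, ht⟩ := h
  have : ((t : ℕ) : ℝ) + 1 ≤ M.σ := by exact_mod_cast t.2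
  linarith [ht.2]

/-- The right end `σ + 1` of the query never excludes a voter of the model, so only the left end is
tested. -/
theorem Learns.left_le {c : ℝ} (hc : c ∈ C) : M.Learns C v 1 (fun x => decide (c ≤ x.1)) := by
  have htop : (M.σ : ℝ) + 1 ∈ segmentEndpoints M.σ :=
    Finset.mem_image.2 ⟨M.σ + 1, Finset.mem_Icc.2 ⟨by omega, le_rfl⟩, by push_cast; rfl⟩
  refine (Learns.answer (Query.interval c (M.σ + 1) (Finset.mem_union_left _ hc)
    (Finset.mem_union_right _ htop))).congr fun x hx => ?_
  simp only [Query.answer, Set.Icc_subset_Icc_iff hx.1, decide_eq_decide]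
  exact and_iff_left hx.le_add_one

theorem Learns.lt_right {c : ℝ} (hc : c ∈ C) : M.Learns C v 1 (fun x => decide (c < x.2)) := by
  have hone : (1 : ℝ) ∈ segmentEndpoints M.σ :=
    Finset.mem_image.2 ⟨1, Finset.mem_Icc.2 ⟨le_rfl, by omega⟩, Nat.cast_one⟩
  refine ((Learns.answer (Query.interval 1 c (Finset.mem_union_right _ hone)
    (Finset.mem_union_left _ hc))).map Bool.not).congr fun x hx => ?_
  simp only [Query.answer, Set.Icc_subset_Icc_iff hx.1]
  rw [← decide_not, decide_eq_decide, not_and, not_le]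
  exact ⟨fun h => h hx.one_le, fun h _ => h⟩

/-- A finite set of reals has at most one greatest element. -/
theorem card_filter_forall_le_le_one (S : Finset ℝ) :
    {c ∈ S | ∀ b ∈ S, b ≤ c}.card ≤ 1 := by
  refine Finset.card_le_one.2 fun a ha b hb => ?_
  rw [Finset.mem_filter] at ha hb
  exact le_antisymm (hb.2 a ha.1) (ha.2 b hb.1)

theorem card_filter_forall_ge_le_one (S : Finset ℝ) :
    {c ∈ S | ∀ b ∈ S, c ≤ b}.card ≤ 1 := by
  refine Finset.card_le_one.2 fun a ha b hb => ?_
  rw [Finset.mem_filter] at ha hb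
  exact le_antisymm (ha.2 b hb.1) (hb.2 a ha.1)

/-- The approved candidates can be found by two binary searches for the endpoints of the approval
interval, followed by one point query at each end. -/
theorem Learns.approved {d : ℕ} (hd : C.card < 2 ^ d) :
    M.Learns C v (d + (d + 2)) (fun x => approved C x) := by
  classical
  have hL : M.Learns C v d (fun x => {c ∈ C | c ≤ x.1}) :=
    binarySearch (p := fun x c => c ≤ x.1) (fun _ _ _ h h' => h.trans h')
      (fun c hc => by convert left_le hc) d C subset_rfl hd
  have hR : M.Learns C v d (fun x => {c ∈ C | c < x.2}) :=
    binarySearch (p := fun x c => c < x.2) (fun _ _ _ h h' => h.trans_lt h')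
      (fun c hc => by convert lt_right hc) d C subset_rfl hd
  -- `R \ L` holds the candidates strictly inside the approval interval. A candidate at its left end
  -- is the greatest of `L`, one at its right end the least of `C \ R`.
  let border (L R : Finset ℝ) : Finset ℝ :=
    {c ∈ L | ∀ b ∈ L, b ≤ c} ∪ {c ∈ C \ R | ∀ b ∈ C \ R, c ≤ b}
  have hborder : ∀ L R, (border L R).card ≤ 2 := fun L R =>
    (Finset.card_union_le _ _).trans
      (Nat.add_le_add (card_filter_forall_le_le_one _) (card_filter_forall_ge_le_one _))
  refine (hL.bind (d₂ := d + 2)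
    (g₂ := fun L x => ({c ∈ C | c < x.2} \ L) ∪
      {c ∈ UniformRIV.approved C x | c ∈ border L {c ∈ C | c < x.2}}) fun L =>
    hR.bind (d₂ := 2) (g₂ := fun R x => (R \ L) ∪
      {c ∈ UniformRIV.approved C x | c ∈ border L R}) fun R =>
    ((approved_filter (border L R)).mono (hborder L R)).map fun U => (R \ L) ∪ U).congr
    fun x hx => ?_
  ext c
  simp only [UniformRIV.approved, border, Finset.mem_union, Finset.mem_sdiff, Finset.mem_filter,
    Set.mem_Icc, not_and, not_le, not_lt]
  constructor
  · rintro (⟨⟨hc, hlt⟩, hle⟩ | h)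
    · exact ⟨hc, (hle hc).le, hlt.le⟩
    · exact h.1
  · rintro ⟨hc, h1, h2⟩
    rcases h1.lt_or_eq with h1' | rfl
    · rcases h2.lt_or_eq with h2' | rfl
      · exact Or.inl ⟨⟨hc, h2'⟩, fun _ => h1'⟩
      · exact Or.inr ⟨⟨hc, h1, h2⟩, Or.inr ⟨⟨hc, fun _ => le_rfl⟩, fun b hb => hb.2 hb.1⟩⟩
    · exact Or.inr ⟨⟨hc, h1, h2⟩, Or.inl ⟨⟨hc, le_rfl⟩, fun b hb => hb.2⟩⟩

/-- What can be learned about every single voter can be learned about all voters. -/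
theorem exists_queryAlgorithm_of_learns {β : Type} [Inhabited β] {d : ℕ} {g : ℝ × ℝ → β}
    (h : ∀ v : Fin n, M.Learns C v d g) (s : Finset (Fin n))
    (next : (Fin n → β) → QueryAlgorithm M.σ C n) :
    ∃ P : QueryAlgorithm M.σ C n, ∀ z : Fin n → ℝ × ℝ, ∃ u : Fin n → β,
      (∀ v ∈ s, M.IsVoter (z v) → u v = g (z v)) ∧ P.run z = (next u).run z ∧
      ∀ w, P.queries z w ≤ (if w ∈ s then d else 0) + (next u).queries z w := by
  induction s using Finset.induction_on generalizing next with
  | empty => exact ⟨next default, fun z => ⟨default, by simp, rfl, by simp⟩⟩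
  | insert a s ha ih =>
    choose Q hQ using fun b : β => ih fun u => next (Function.update u a b)
    obtain ⟨P, hP⟩ := h a Q
    refine ⟨P, fun z => ?_⟩
    obtain ⟨b, hb, hrun, hq⟩ := hP z
    obtain ⟨u, hu, hrun', hq'⟩ := hQ b z
    refine ⟨Function.update u a b, fun v hv hz => ?_, hrun.trans hrun', fun w => ?_⟩
    · rcases eq_or_ne v a with rfl | hva
      · rw [Function.update_self, hb hz]
      · rw [Function.update_of_ne hva]
        exact hu v ((Finset.mem_insert.1 hv).resolve_left hva) hz
    · have h1 := hq w
      have h2 := hq' w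
      rcases eq_or_ne a w with rfl | haw
      · rw [if_pos rfl] at h1
        rw [if_neg ha] at h2
        rw [if_pos (Finset.mem_insert_self _ _)]
        omega
      · rw [if_neg haw] at h1
        have : w ∈ insert a s ↔ w ∈ s := by simp [Finset.mem_insert, haw.symm]
        simp only [this]
        omega

end UniformRIV

/-! ### Assembling the algorithm -/

theorem intervalElection_exists_inCore {n k : ℕ} (hn : 1 ≤ n) {C : Finset ℝ} (hk : k ≤ C.card)
    (z : Fin n → ℝ × ℝ) : ∃ W, (intervalElection C k z).InCore W := by
  have : Nonempty (Fin n) := ⟨⟨0, hn⟩⟩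
  refine Election.exists_inCore _ hk fun v x hx y hy c hc hxc hcy => ?_
  simp only [intervalElection, Finset.mem_filter, Set.mem_Icc] at hx hy hc ⊢
  exact ⟨hc, hx.2.1.trans hxc, hcy.trans hy.2.2⟩

/-- An election with at most one candidate has a core stable committee that does not depend on the
votes. -/
theorem exists_forall_inCore_of_card_le_one {n k : ℕ} (hn : 1 ≤ n) {C : Finset ℝ}
    (hC : C.card ≤ 1) (hk : k ≤ C.card) :
    ∃ W, ∀ z : Fin n → ℝ × ℝ, (intervalElection C k z).InCore W := by
  rcases Nat.eq_zero_or_pos k with rfl | hk0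
  · refine ⟨∅, fun z => ⟨Finset.empty_subset _, rfl, fun ℓ h1 h2 => ?_⟩⟩
    exact absurd (h1.trans h2) (by simp [intervalElection])
  · refine ⟨C, fun z => ⟨subset_rfl, le_antisymm (hC.trans hk0) hk,
      fun ℓ h1 h2 T hT _ G hG => ?_⟩⟩
    have hkpos : (0 : ℝ) < ((intervalElection C k z).k : ℝ) := by
      exact_mod_cast (show 0 < k from hk0)
    have hℓ : (0 : ℝ) < ℓ := by exact_mod_cast h1
    have hnpos : (0 : ℝ) < (Fintype.card (Fin n) : ℝ) := by
      rw [Fintype.card_fin]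
      exact_mod_cast hn
    have hG0 : (0 : ℝ) < G.card := (by positivity : (0 : ℝ) < _).trans_le hG
    obtain ⟨v, hv⟩ := Finset.card_pos.1 (by exact_mod_cast hG0 : 0 < G.card)
    exact ⟨v, hv, Finset.card_le_card (Finset.inter_subset_inter_right hT)⟩

instance UniformRIV.isProbabilityMeasure_profileLaw (M : UniformRIV) (n : ℕ) :
    IsProbabilityMeasure (M.profileLaw n) := by
  unfold UniformRIV.profileLaw
  infer_instance

/-- For `m ≥ 2` the additive `4` is absorbed by `log m ≥ log 2`: `2 / 0.69 + 4 / log 2 < 9`. -/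
theorem two_mul_log_add_four_le {m : ℕ} (hm : 2 ≤ m) :
    (((Nat.log 2 m + 1) + ((Nat.log 2 m + 1) + 2) : ℕ) : ℝ) ≤ 9 * Real.log m := by
  have hlog2 := Real.log_two_gt_d9
  have h1 : Real.log 2 ≤ Real.log m := Real.log_le_log two_pos (by exact_mod_cast hm)
  have h2 : (Nat.log 2 m : ℝ) * Real.log 2 ≤ Real.log m := by
    rw [← Real.log_pow]
    exact Real.log_le_log (by positivity) (by exact_mod_cast Nat.pow_log_le_self 2 (by omega))
  have h3 : (Nat.log 2 m : ℝ) * 0.69 ≤ (Nat.log 2 m : ℝ) * Real.log 2 :=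
    mul_le_mul_of_nonneg_left (by linarith) (Nat.cast_nonneg _)
  push_cast
  linarith

theorem corollary1 :
    ∃ K : ℝ, 0 < K ∧
      ∀ (M : UniformRIV) (C : Finset ℝ), (C : Set ℝ) ⊆ ⋃ t, M.segment t →
        ∀ n k : ℕ, 1 ≤ n → k ≤ C.card →
          ∃ P : QueryAlgorithm M.σ C n,
            (∀ z : Fin n → ℝ × ℝ, (∀ v, M.IsVoter (z v)) →
              (intervalElection C k z).InCore (P.run z)) ∧
            ∀ v : Fin n,
              ∫⁻ z, (P.queries z v : ℝ≥0∞) ∂(M.profileLaw n) ≤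
                ENNReal.ofReal (K * Real.log (C.card : ℝ)) := by
  refine ⟨9, by norm_num, fun M C _ n k hn hk => ?_⟩
  -- Here the logarithm is `0`, so no query is allowed.
  rcases le_or_gt C.card 1 with hC | hC
  · obtain ⟨W, hW⟩ := exists_forall_inCore_of_card_le_one hn hC hk
    exact ⟨.output W, fun z _ => hW z, fun v => by simp [QueryAlgorithm.queries]⟩
  classical
  -- The committee may depend only on the learned sets `u`; for a `u` that no profile realises, `∅`
  -- serves as a default.
  have hchoice : ∀ u : Fin n → Finset ℝ, ∃ W : Finset ℝ, ∀ z : Fin n → ℝ × ℝ,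
      (∀ v, u v = UniformRIV.approved C (z v)) → (intervalElection C k z).InCore W := by
    intro u
    by_cases hu : ∃ z : Fin n → ℝ × ℝ, ∀ v, u v = UniformRIV.approved C (z v)
    · obtain ⟨z₀, hz₀⟩ := hu
      obtain ⟨W, hW⟩ := intervalElection_exists_inCore hn hk z₀
      refine ⟨W, fun z hz => ?_⟩
      have hE : intervalElection C k z = intervalElection C k z₀ := by
        have : ∀ v, (intervalElection C k z).A v = (intervalElection C k z₀).A v := fun v => by
          have := (hz v).symm.trans (hz₀ v)
          ext c
          have := Finset.ext_iff.1 this c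
          simpa [UniformRIV.approved, intervalElection] using this
        have h' := funext this
        unfold intervalElection at h' ⊢
        congr 1
      exact hE ▸ hW
    · exact ⟨∅, fun z hz => absurd ⟨z, hz⟩ hu⟩
  choose W hW using hchoice
  obtain ⟨P, hP⟩ := UniformRIV.exists_queryAlgorithm_of_learns (M := M)
    (fun v : Fin n => UniformRIV.Learns.approved (v := v)
      (Nat.lt_pow_succ_log_self one_lt_two C.card)) Finset.univ (fun u => .output (W u))
  refine ⟨P, fun z hz => ?_, fun v => ?_⟩
  · obtain ⟨u, hu, hrun, -⟩ := hP z
    rw [hrun]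
    exact hW u z fun v => hu v (Finset.mem_univ v) (hz v)
  · have hq : ∀ z, (P.queries z v : ℝ≥0∞) ≤ ENNReal.ofReal (9 * Real.log C.card) := by
      intro z
      obtain ⟨u, -, -, hq⟩ := hP z
      have h := hq v
      rw [if_pos (Finset.mem_univ v)] at h
      rw [← ENNReal.ofReal_natCast]
      exact ENNReal.ofReal_le_ofReal
        ((Nat.cast_le.2 h).trans (two_mul_log_add_four_le hC))
    calc ∫⁻ z, (P.queries z v : ℝ≥0∞) ∂(M.profileLaw n)
        ≤ ∫⁻ _, ENNReal.ofReal (9 * Real.log C.card) ∂(M.profileLaw n) := lintegral_mono hq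
      _ = ENNReal.ofReal (9 * Real.log C.card) := by simp
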